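/- Let $(M,g)$ be a time-oriented Lorentzian manifold: $M$ is a smooth, Hausdorff, paracompact, finite-dimensional manifold without boundary, $g$ is a smooth metric of signature $(-,+,\dots,+)$, and the time orientation is given by a continuous timelike vector field. Curves are piecewise $C^1$, and their (one-sided) tangent vectors are non-zero everywhere. Let $I^+(x)$ be the set of $y\in M$ for which there is a future directed timelike curve from $x$ to $y$. The Lorentzian distance $d(x,y;g)\in[0,\infty]$ is the supremum of the lengths $L(\gamma;g)=\int\sqrt{-g(\gamma',\gamma')}$ over all future directed causal curves $\gamma$ from $x$ to $y$, and it is $0$ if there are no such curves. A future directed sequence converging to $x$ is a sequence $(x_i)_{i\in\mathbb N}$ in $M$ with $x_i\to x$, $x_{i+1}\in I^+(x_i)$ and $x\in I^+(x_i)$ for all $i$. For such a sequence put $$\mathrm{Miss}^+(x)=\operatorname{Int}\Bigl(\bigl(\textstyle\bigcap_{i} I^+(x_i)\bigr)\setminus I^+(x)\Bigr).$$ Suppose that there are a point $x\in M$ and a future directed sequence $(x_i)$ converging to $x$ for which $\mathrm{Miss}^+(x)\neq\varnothing$. Then for every Lorentzian metric $h$ on $M$ that is conformally related to $g$, i.e.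 $h=\Omega^2g$ for some function $\Omega:M\to\mathbb R$, with the same time orientation, the Lorentzian distance $d(\cdot,\cdot\,;h):M\times M\to[0,\infty]$ is not continuous. In particular $d(\cdot,\cdot\,;g)$ itself is not continuous. -/

import Mathlib

open Set Filter Topology MeasureTheory
open scoped Manifold ContDiff ENNReal

noncomputable section

/-- A smooth Lorentzian metric, of signature `(-,+,…,+)`, on a smooth manifold `M` without boundary
modelled on `E`. The field `signature` says that each tangent space splits orthogonally into a line
on which the form is negative and a complement on which it is positive definite. -/
structure LorentzianMetric (E : Type*) [NormedAddCommGroup E] [NormedSpace ℝ E]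
    (M : Type*) [TopologicalSpace M] [ChartedSpace E M] [IsManifold 𝓘(ℝ, E) ∞ M] where
  /-- The bilinear form on each tangent space. -/
  val (x : M) : TangentSpace 𝓘(ℝ, E) x →L[ℝ] TangentSpace 𝓘(ℝ, E) x →L[ℝ] ℝ
  symm (x : M) (v w : TangentSpace 𝓘(ℝ, E) x) : val x v w = val x w v
  signature (x : M) : ∃ v : TangentSpace 𝓘(ℝ, E) x, val x v v < 0 ∧
    ∀ w : TangentSpace 𝓘(ℝ, E) x, val x v w = 0 → w ≠ 0 → 0 < val x w w
  contMDiff : ContMDiff 𝓘(ℝ, E) (𝓘(ℝ, E).prod 𝓘(ℝ, E →L[ℝ] E →L[ℝ] ℝ)) ∞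
    (fun x ↦ Bundle.TotalSpace.mk' (E →L[ℝ] E →L[ℝ] ℝ)
      (E := fun x : M ↦ TangentSpace 𝓘(ℝ, E) x →L[ℝ] TangentSpace 𝓘(ℝ, E) x →L[ℝ] ℝ) x (val x))

namespace LorentzianMetric

variable {E : Type*} [NormedAddCommGroup E] [NormedSpace ℝ E]
  {M : Type*} [TopologicalSpace M] [ChartedSpace E M] [IsManifold 𝓘(ℝ, E) ∞ M]

/-- The vector field `T` is a time orientation of `g`: it is continuous and everywhere timelike. -/
structure IsTimeOrientation (g : LorentzianMetric E M)
    (T : (x : M) → TangentSpace 𝓘(ℝ, E) x) : Prop where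
  continuous : Continuous (fun x ↦ (⟨x, T x⟩ : TangentBundle 𝓘(ℝ, E) M))
  timelike (x : M) : g.val x (T x) (T x) < 0

/-- `v` is a future directed timelike vector at `x`. -/
def FutureTimelike (g : LorentzianMetric E M) (T : (x : M) → TangentSpace 𝓘(ℝ, E) x) (x : M)
    (v : TangentSpace 𝓘(ℝ, E) x) : Prop :=
  g.val x v v < 0 ∧ g.val x (T x) v < 0

/-- `v` is a future directed causal vector at `x` (in particular `v ≠ 0`). -/
def FutureCausal (g : LorentzianMetric E M) (T : (x : M) → TangentSpace 𝓘(ℝ, E) x) (x : M)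
    (v : TangentSpace 𝓘(ℝ, E) x) : Prop :=
  g.val x v v ≤ 0 ∧ g.val x (T x) v < 0

end LorentzianMetric

section Curves

variable {E : Type*} [NormedAddCommGroup E] [NormedSpace ℝ E]
  {M : Type*} [TopologicalSpace M] [ChartedSpace E M]

/-- `γ : [a, b] → M`, `a < b`, is a piecewise `C¹` curve from `x` to `y` all of whose tangent
vectors lie in `C`. There is a partition `a = t 0 < ⋯ < t n = b` such that `γ` is `C¹` on each closed
interval `[t i, t (i + 1)]`, up to and including its end points, where one-sided derivatives are
taken. Values of `γ` outside `[a, b]` are irrelevant. -/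
structure IsPiecewiseC1CurveIn (C : (x : M) → TangentSpace 𝓘(ℝ, E) x → Prop)
    (γ : ℝ → M) (a b : ℝ) (x y : M) : Prop where
  lt : a < b
  source : γ a = x
  target : γ b = y
  pieces : ∃ (n : ℕ) (t : ℕ → ℝ), t 0 = a ∧ t n = b ∧ ∀ i < n, t i < t (i + 1) ∧
    ContMDiffOn 𝓘(ℝ, ℝ) 𝓘(ℝ, E) 1 γ (Icc (t i) (t (i + 1))) ∧
    ∀ s ∈ Icc (t i) (t (i + 1)),
      C (γ s) (mfderivWithin 𝓘(ℝ, ℝ) 𝓘(ℝ, E) γ (Icc (t i) (t (i + 1))) s (1 : ℝ))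

end Curves

namespace LorentzianMetric

variable {E : Type*} [NormedAddCommGroup E] [NormedSpace ℝ E]
  {M : Type*} [TopologicalSpace M] [ChartedSpace E M] [IsManifold 𝓘(ℝ, E) ∞ M]

/-- The chronological future `I⁺(x)`. -/
def chronFuture (g : LorentzianMetric E M) (T : (x : M) → TangentSpace 𝓘(ℝ, E) x) (x : M) : Set M :=
  {y | ∃ (γ : ℝ → M) (a b : ℝ), IsPiecewiseC1CurveIn (g.FutureTimelike T) γ a b x y}

/-- The Lorentzian arc length `∫ √(-g(γ', γ'))` of `γ` over `[a, b]`. For a piecewise `C¹` curve the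
finitely many break points do not contribute. -/
def arcLength (g : LorentzianMetric E M) (γ : ℝ → M) (a b : ℝ) : ℝ≥0∞ :=
  ∫⁻ t in Icc a b, ENNReal.ofReal (Real.sqrt (-(g.val (γ t)
    (mfderiv 𝓘(ℝ, ℝ) 𝓘(ℝ, E) γ t (1 : ℝ)) (mfderiv 𝓘(ℝ, ℝ) 𝓘(ℝ, E) γ t (1 : ℝ)))))

/-- The Lorentzian distance `d(x, y) ∈ [0, ∞]`: the supremum of the lengths of the future directed
causal curves from `x` to `y`, which is `0` if there are none. -/
def lorentzDist (g : LorentzianMetric E M) (T : (x : M) → TangentSpace 𝓘(ℝ, E) x) (x y : M) :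
    ℝ≥0∞ :=
  ⨆ (γ : ℝ → M) (a : ℝ) (b : ℝ) (_ : IsPiecewiseC1CurveIn (g.FutureCausal T) γ a b x y),
    g.arcLength γ a b

/-- `u` is a future directed sequence converging to `x`: `u i ≪ u (i + 1)` and `u i ≪ x` for all
`i`, and `u i → x`. -/
structure IsFutureDirectedSeqTo (g : LorentzianMetric E M)
    (T : (x : M) → TangentSpace 𝓘(ℝ, E) x) (u : ℕ → M) (x : M) : Prop where
  chain (i : ℕ) : u (i + 1) ∈ g.chronFuture T (u i)
  below (i : ℕ) : x ∈ g.chronFuture T (u i)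
  tendsto : Tendsto u atTop (𝓝 x)

/-- `Miss⁺(x)`, computed with the future directed sequence `u` converging to `x`. -/
def missFuture (g : LorentzianMetric E M) (T : (x : M) → TangentSpace 𝓘(ℝ, E) x) (u : ℕ → M)
    (x : M) : Set M :=
  interior ((⋂ i, g.chronFuture T (u i)) \ g.chronFuture T x)

/-- `h = Ω² g` for some function `Ω`. As `g` and `h` are both Lorentzian metrics, `Ω` has no zeros
and `|Ω|` is smooth. -/
def ConformallyRelated (g h : LorentzianMetric E M) : Prop :=
  ∃ Ω : M → ℝ, ∀ (x : M) (v w : TangentSpace 𝓘(ℝ, E) x), h.val x v w = Ω x ^ 2 * g.val x v w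

/-- A time orientation of `g` is one of every metric conformally related to `g`. -/
theorem IsTimeOrientation.conformal {g h : LorentzianMetric E M}
    {T : (x : M) → TangentSpace 𝓘(ℝ, E) x} (hT : g.IsTimeOrientation T)
    (hgh : g.ConformallyRelated h) : h.IsTimeOrientation T := by
  obtain ⟨Ω, hΩ⟩ := hgh
  refine ⟨hT.continuous, fun x ↦ ?_⟩
  have h0 : Ω x ≠ 0 := by
    intro h0
    obtain ⟨v, hv, -⟩ := h.signature x
    rw [hΩ, h0] at hv
    simp at hv
  rw [hΩ]
  exact mul_neg_of_pos_of_neg (by positivity) (hT.timelike x)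

end LorentzianMetric

end

/-!
Let `z ∈ Miss⁺(x)`. The function `d(·, z)` jumps at `x`: it is bounded below by a positive constant
along the sequence `x_i → x`, while it vanishes at `x`.

*Lower bound.* As `z ∈ I⁺(x_0)`, some timelike curve ends at `z`. A final arc of it starts
at some point `w` of the open set `Miss⁺(x)`, and its length is positive. Since `w ∈ I⁺(x_i)` for
all `i`, a timelike curve from `x_i` to `w` followed by this arc shows that `d(x_i, z)` is at least
the length of the arc, whatever `i` is
(`arcLength_le_lorentzDist_of_mem_chronFuture`).

*Vanishing.* There is no causal curve from `x` to `z` at all: the end point of a causal curve from `x`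
lies in the closure of `I⁺(x)` (`mem_closure_chronFuture`), whereas `Miss⁺(x)` is an open set
disjoint from `I⁺(x)`. The closure statement is proved by pushing a causal curve into the timelike
cone. Locally, in a chart, one adds `ε (t - s₁) V` to the curve, where `V` is a future directed
timelike constant vector field (`exists_timelike_perturbation`); the metric being `C¹`, hence locally
Lipschitz, the curve becomes timelike on short parameter intervals. There is room for an additional
small displacement of the initial point. This is what allows the local perturbations to be chained,
and it is recorded in the transitive relation `ApproxChron`.

A conformal change of the metric changes neither the timelike cones nor the sets `I⁺` and `Miss⁺`, so
the argument applies to each conformally related metric in place of `g`.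
-/

/-! ### Perturbation in a vector space -/

/-- A causal curve `σ` in a vector space with a `C¹` Lorentzian metric `G` can be pushed into the
timelike cone: near each parameter `s`, the curve `t ↦ σ t + η + ε (t - s₁) • V` is timelike, where
`V` is the time orientation at `σ s` extended as a constant vector field, `ε` is small, and the
initial displacement `η` is small compared with `ε`. The gain `2 ε G(σ', V) < 0` beats the loss
`O(‖η‖ + ε (t - s₁))` caused by the Lipschitz variation of `G`, as long as `t - s₁` is small. -/
lemma exists_timelike_perturbation {E : Type*} [NormedAddCommGroup E] [NormedSpace ℝ E]
    {Ω : Set E} (hΩ : IsOpen Ω) {G : E → E →L[ℝ] E →L[ℝ] ℝ} (hG : ContDiffOn ℝ 1 G Ω)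
    (hsymm : ∀ q ∈ Ω, ∀ v w, G q v w = G q w v)
    {X : E → E} (hX : ContinuousOn X Ω) (hXX : ∀ q ∈ Ω, G q (X q) (X q) < 0)
    {σ : ℝ → E} {c d : ℝ} (hcd : c < d) (hσ : ContDiffOn ℝ 1 σ (Icc c d))
    (hσΩ : MapsTo σ (Icc c d) Ω)
    (hcaus : ∀ t ∈ Icc c d,
      G (σ t) (derivWithin σ (Icc c d) t) (derivWithin σ (Icc c d) t) ≤ 0 ∧
      G (σ t) (X (σ t)) (derivWithin σ (Icc c d) t) < 0)
    {s : ℝ} (hs : s ∈ Icc c d) :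
    ∃ τ > 0, ∀ s₁ s₂, s₁ < s₂ → c ≤ s₁ → s₂ ≤ d → s - τ < s₁ → s₂ < s + τ →
      ∀ W ∈ 𝓝 (σ s₂), ∀ᶠ p in 𝓝 (σ s₁), ∃ ρ : ℝ → E, ContDiffOn ℝ 1 ρ (Icc s₁ s₂) ∧
        ρ s₁ = p ∧ ρ s₂ ∈ W ∧ ∀ t ∈ Icc s₁ s₂, ρ t ∈ Ω ∧
          G (ρ t) (derivWithin ρ (Icc s₁ s₂) t) (derivWithin ρ (Icc s₁ s₂) t) < 0 ∧
          G (ρ t) (X (ρ t)) (derivWithin ρ (Icc s₁ s₂) t) < 0 := by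
  set v : ℝ → E := derivWithin σ (Icc c d) with hv
  set V : E := X (σ s) with hV
  have hΩs : Ω ∈ 𝓝 (σ s) := hΩ.mem_nhds (hσΩ hs)
  have hGs : ContinuousAt G (σ s) := (hG.contDiffAt hΩs).continuousAt
  have hXs : ContinuousAt X (σ s) := hX.continuousAt hΩs
  obtain ⟨κ, hκ, hκV⟩ : ∃ κ > 0, G (σ s) (v s) V < -κ := by
    have h := (hcaus s hs).2
    rw [hsymm _ (hσΩ hs)] at h
    exact ⟨-(G (σ s) (v s) V) / 2, by linarith, by linarith⟩
  have hG1 : ContinuousAt (fun z : E × E ↦ G z.1) (σ s, v s) :=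
    ContinuousAt.comp (f := Prod.fst) (g := G) hGs continuousAt_fst
  have hX1 : ContinuousAt (fun z : E × E ↦ X z.1) (σ s, v s) :=
    ContinuousAt.comp (f := Prod.fst) (g := X) hXs continuousAt_fst
  have hev : ∀ᶠ z : E × E in 𝓝 (σ s, v s), z.1 ∈ Ω ∧ G z.1 V V < 0 ∧ G z.1 z.2 V < -κ ∧
      G z.1 (X z.1) z.2 < 0 := by
    refine ((continuous_fst.tendsto (σ s, v s)).eventually hΩs).and (.and ?_ (.and ?_ ?_))
    · exact ((hG1.clm_apply continuousAt_const).clm_apply continuousAt_const).eventually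
        (gt_mem_nhds (hXX _ (hσΩ hs)))
    · exact ((hG1.clm_apply continuousAt_snd).clm_apply continuousAt_const).eventually
        (gt_mem_nhds hκV)
    · exact ((hG1.clm_apply hX1).clm_apply continuousAt_snd).eventually
        (gt_mem_nhds (hcaus s hs).2)
  -- `κ` bounds the gain, and `L` and `B` bound the loss, on a ball of radius `r` around `(σ s, v s)`.
  obtain ⟨L, S, hS, hLip⟩ := (hG.contDiffAt hΩs).exists_lipschitzOnWith
  obtain ⟨r₁, hr₁, hball⟩ := Metric.eventually_nhds_iff.1 hev
  obtain ⟨r₂, hr₂, hS⟩ := Metric.mem_nhds_iff.1 hS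
  obtain ⟨r, hr, hrr₁, hrr₂⟩ : ∃ r > 0, r ≤ r₁ ∧ r ≤ r₂ :=
    ⟨min r₁ r₂, lt_min hr₁ hr₂, min_le_left _ _, min_le_right _ _⟩
  have hnear : ∀ q w, ‖q - σ s‖ < r → ‖w - v s‖ < r → q ∈ Ω ∧ G q V V < 0 ∧ G q w V < -κ ∧
      G q (X q) w < 0 := by
    intro q w hq hw
    refine hball (y := (q, w)) ?_
    rw [Prod.dist_eq, dist_eq_norm, dist_eq_norm]
    exact (max_lt hq hw).trans_le hrr₁
  set B : ℝ := ‖v s‖ + r with hB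
  have hLipB : ∀ q q' w, ‖q - σ s‖ < r → ‖q' - σ s‖ < r → ‖w - v s‖ < r →
      G q w w ≤ G q' w w + L * ‖q - q'‖ * B ^ 2 := by
    intro q q' w hq hq' hw
    have h1 : ‖G q - G q'‖ ≤ L * ‖q - q'‖ := by
      refine lipschitzOnWith_iff_norm_sub_le.1 hLip (hS ?_) (hS ?_)
      · rw [Metric.mem_ball, dist_eq_norm]; exact hq.trans_le hrr₂
      · rw [Metric.mem_ball, dist_eq_norm]; exact hq'.trans_le hrr₂
    have h2 : ‖w‖ ≤ B := by
      have := norm_add_le (v s) (w - v s)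
      rw [add_sub_cancel] at this
      linarith
    have h3 : (G q - G q') w w ≤ ‖G q - G q'‖ * ‖w‖ * ‖w‖ :=
      (le_abs_self _).trans ((G q - G q').le_opNorm₂ w w)
    have h4 : ‖G q - G q'‖ * ‖w‖ * ‖w‖ ≤ L * ‖q - q'‖ * B * B := by gcongr
    simp only [sub_apply] at h3
    linarith [h3, h4, sq B, mul_assoc (L * ‖q - q'‖) B B, congrArg (L * ‖q - q'‖ * ·) (sq B)]
  have hvc : ContinuousOn v (Icc c d) :=
    hσ.continuousOn_derivWithin (uniqueDiffOn_Icc hcd) le_rfl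
  obtain ⟨τ₁, hτ₁, h₁⟩ := Metric.continuousOn_iff.1 hσ.continuousOn s hs (r / 3) (by positivity)
  obtain ⟨τ₂, hτ₂, h₂⟩ := Metric.continuousOn_iff.1 hvc s hs (r / 2) (by positivity)
  set K : ℝ := L * ‖V‖ * B ^ 2 with hK
  have hK0 : 0 ≤ K := by positivity
  -- The last bound makes the loss `L ε (t - s₁) ‖V‖ B²` smaller than `ε κ`, half of the gain.
  refine ⟨min (min τ₁ τ₂) (κ / (2 * (K + 1))), by positivity, ?_⟩
  intro s₁ s₂ hlt hcs hsd hτs₁ hτs₂ W hW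
  have hsub : Icc s₁ s₂ ⊆ Icc c d := Icc_subset_Icc hcs hsd
  have hτ : ∀ t ∈ Icc s₁ s₂, |t - s| < min (min τ₁ τ₂) (κ / (2 * (K + 1))) := fun t ht ↦ by
    rw [abs_lt]; constructor <;> linarith [ht.1, ht.2]
  have hσt : ∀ t ∈ Icc s₁ s₂, ‖σ t - σ s‖ < r / 3 := fun t ht ↦ by
    rw [← dist_eq_norm]
    exact h₁ t (hsub ht) ((hτ t ht).trans_le ((min_le_left _ _).trans (min_le_left _ _)))
  have hvt : ∀ t ∈ Icc s₁ s₂, ‖v t - v s‖ < r / 2 := fun t ht ↦ by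
    rw [← dist_eq_norm]
    exact h₂ t (hsub ht) ((hτ t ht).trans_le ((min_le_left _ _).trans (min_le_right _ _)))
  have hlen : K * (s₂ - s₁) < κ := by
    have h3 : s₂ - s₁ < 2 * (κ / (2 * (K + 1))) := by
      have := min_le_right (min τ₁ τ₂) (κ / (2 * (K + 1)))
      linarith
    have h4 : 2 * (κ / (2 * (K + 1))) * (K + 1) = κ := by field_simp
    nlinarith
  obtain ⟨δ, hδ, hδW⟩ := Metric.mem_nhds_iff.1 hW
  set ℓ := s₂ - s₁ with hℓ
  have hℓ0 : 0 < ℓ := sub_pos.2 hlt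
  obtain ⟨ε, hε, hε₁, hε₂, hε₃⟩ : ∃ ε > 0, ε * ‖V‖ < r / 2 ∧ ε * ℓ * ‖V‖ < r / 3 ∧
      ε * ℓ * ‖V‖ < δ / 2 := by
    have hlim : ∀ a : ℝ, Tendsto (fun ε : ℝ ↦ ε * a) (𝓝[>] 0) (𝓝 0) := fun a ↦ by
      have : Tendsto (fun ε : ℝ ↦ ε * a) (𝓝 0) (𝓝 (0 * a)) :=
        (continuous_id.mul continuous_const).tendsto 0
      rw [zero_mul] at this
      exact this.mono_left nhdsWithin_le_nhds
    have e := ((hlim ‖V‖).eventually (gt_mem_nhds (show 0 < r / 2 by positivity))).and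
      (((hlim (ℓ * ‖V‖)).eventually (gt_mem_nhds (show 0 < r / 3 by positivity))).and
      ((hlim (ℓ * ‖V‖)).eventually (gt_mem_nhds (show 0 < δ / 2 by positivity))))
    obtain ⟨ε, ⟨e1, e2, e3⟩, e4⟩ := (e.and self_mem_nhdsWithin).exists
    exact ⟨ε, e4, e1, by rwa [mul_assoc], by rwa [mul_assoc]⟩
  -- With `ε` fixed, the bound on `η` makes the loss `L ‖η‖ B²` at most `ε κ`, the other half.
  have hη : ∀ᶠ p in 𝓝 (σ s₁), ‖p - σ s₁‖ < min (min (r / 3) (δ / 2)) (ε * κ / (L * B ^ 2 + 1)) := by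
    filter_upwards [Metric.ball_mem_nhds (σ s₁)
      (show 0 < min (min (r / 3) (δ / 2)) (ε * κ / (L * B ^ 2 + 1)) by positivity)] with p hp
    rwa [Metric.mem_ball, dist_eq_norm] at hp
  filter_upwards [hη] with p hp
  set η := p - σ s₁ with hη
  have hη₁ : ‖η‖ < r / 3 := hp.trans_le ((min_le_left _ _).trans (min_le_left _ _))
  have hη₂ : ‖η‖ < δ / 2 := hp.trans_le ((min_le_left _ _).trans (min_le_right _ _))
  have hη₃ : L * ‖η‖ * B ^ 2 ≤ ε * κ := by
    have h3 := hp.trans_le (min_le_right _ _)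
    rw [lt_div_iff₀ (by positivity)] at h3
    nlinarith [norm_nonneg η]
  set ρ : ℝ → E := fun t ↦ σ t + η + (ε * (t - s₁)) • V with hρ
  have hshift : ∀ t ∈ Icc s₁ s₂, ‖(ε * (t - s₁)) • V‖ ≤ ε * ℓ * ‖V‖ := fun t ht ↦ by
    have h3 : 0 ≤ t - s₁ := by linarith [ht.1]
    have h4 : t - s₁ ≤ ℓ := by linarith [ht.2]
    rw [norm_smul, Real.norm_eq_abs, abs_of_nonneg (by positivity)]
    gcongr
  have hρσ : ∀ t ∈ Icc s₁ s₂, ‖ρ t - σ t‖ ≤ ‖η‖ + ε * ℓ * ‖V‖ := fun t ht ↦ by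
    have : ρ t - σ t = η + (ε * (t - s₁)) • V := by simp only [hρ]; abel
    rw [this]
    exact (norm_add_le _ _).trans (by linarith [hshift t ht])
  have hderiv : ∀ t ∈ Icc s₁ s₂, derivWithin ρ (Icc s₁ s₂) t = v t + ε • V := fun t ht ↦ by
    have hσ' : HasDerivWithinAt σ (v t) (Icc s₁ s₂) t :=
      ((hσ.differentiableOn one_ne_zero t (hsub ht)).hasDerivWithinAt).mono hsub
    have hlin : HasDerivWithinAt (fun t ↦ (ε * (t - s₁)) • V) (ε • V) (Icc s₁ s₂) t := by
      have h3 : HasDerivAt (fun t : ℝ ↦ ε * (t - s₁)) ε t := by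
        simpa using ((hasDerivAt_id t).sub_const s₁).const_mul ε
      exact (h3.smul_const V).hasDerivWithinAt
    exact ((hσ'.add_const η).add hlin).derivWithin (uniqueDiffOn_Icc hlt t ht)
  refine ⟨ρ, ?_, by simp [hρ, hη], hδW ?_, fun t ht ↦ ?_⟩
  · have h3 : ContDiff ℝ 1 (fun t : ℝ ↦ (ε * (t - s₁)) • V) := by fun_prop
    exact ((hσ.mono hsub).add contDiffOn_const).add h3.contDiffOn
  · rw [Metric.mem_ball, dist_eq_norm]
    have := hρσ s₂ (right_mem_Icc.2 hlt.le)
    linarith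
  · rw [hderiv t ht]
    have hq : ‖ρ t - σ s‖ < r := by
      have h3 := norm_add_le (ρ t - σ t) (σ t - σ s)
      rw [sub_add_sub_cancel] at h3
      linarith [hρσ t ht, hσt t ht]
    have hεV : ‖ε • V‖ = ε * ‖V‖ := by rw [norm_smul, Real.norm_eq_abs, abs_of_pos hε]
    have hw : ‖v t + ε • V - v s‖ < r := by
      have h3 := norm_add_le (v t - v s) (ε • V)
      have h4 : v t - v s + ε • V = v t + ε • V - v s := by abel
      rw [h4] at h3
      linarith [hvt t ht]
    obtain ⟨hΩt, hVV, -, hXw⟩ := hnear _ _ hq hw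
    obtain ⟨-, -, hvV, -⟩ := hnear _ (v t) hq (by linarith [hvt t ht])
    refine ⟨hΩt, ?_, hXw⟩
    have hmain := hLipB (ρ t) (σ t) (v t) hq (by linarith [hσt t ht]) (by linarith [hvt t ht])
    have h0 := (hcaus t (hsub ht)).1
    have hexp : G (ρ t) (v t + ε • V) (v t + ε • V) =
        G (ρ t) (v t) (v t) + 2 * ε * G (ρ t) (v t) V + ε ^ 2 * G (ρ t) V V := by
      simp only [map_add, map_smul, add_apply, smul_apply, smul_eq_mul,
        hsymm _ hΩt V (v t)]
      ring
    rw [hexp]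
    have h5 : L * ‖ρ t - σ t‖ * B ^ 2 ≤ L * (‖η‖ + ε * ℓ * ‖V‖) * B ^ 2 := by
      gcongr
      exact hρσ t ht
    have h6 : L * (‖η‖ + ε * ℓ * ‖V‖) * B ^ 2 = L * ‖η‖ * B ^ 2 + ε * (K * ℓ) := by
      rw [hK]; ring
    have h7 : ε * (K * ℓ) < ε * κ := mul_lt_mul_of_pos_left hlen hε
    have h8 : 2 * ε * G (ρ t) (v t) V < 2 * ε * (-κ) := mul_lt_mul_of_pos_left hvV (by positivity)
    have h9 : ε ^ 2 * G (ρ t) V V < 0 := mul_neg_of_pos_of_neg (by positivity) hVV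
    linarith

/-! ### Coordinate expressions -/

namespace LorentzianMetric

variable {E : Type*} [NormedAddCommGroup E] [NormedSpace ℝ E]
  {M : Type*} [TopologicalSpace M] [ChartedSpace E M] [IsManifold 𝓘(ℝ, E) ∞ M]

/-- The coordinate frame of the preferred chart at `x₀`: the vector with coordinates `v` at the
point with coordinates `q`. -/
noncomputable def chartVec (x₀ : M) (q : E) :
    E →L[ℝ] TangentSpace 𝓘(ℝ, E) ((extChartAt 𝓘(ℝ, E) x₀).symm q) :=
  (trivializationAt E (TangentSpace 𝓘(ℝ, E)) x₀).symmL ℝ ((extChartAt 𝓘(ℝ, E) x₀).symm q)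

/-- The metric `g` in the coordinates of the preferred chart at `x₀`. -/
noncomputable def chartMetric (g : LorentzianMetric E M) (x₀ : M) (q : E) : E →L[ℝ] E →L[ℝ] ℝ :=
  ContinuousLinearMap.bilinearComp (E := E) (F := E) (G := ℝ)
    (g.val ((extChartAt 𝓘(ℝ, E) x₀).symm q)) (chartVec x₀ q) (chartVec x₀ q)

/-- The vector field `T` in the coordinates of the preferred chart at `x₀`. -/
noncomputable def chartField (T : (x : M) → TangentSpace 𝓘(ℝ, E) x) (x₀ : M) (q : E) : E :=
  (trivializationAt E (TangentSpace 𝓘(ℝ, E)) x₀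
    ⟨(extChartAt 𝓘(ℝ, E) x₀).symm q, T ((extChartAt 𝓘(ℝ, E) x₀).symm q)⟩).2

@[simp]
lemma chartMetric_apply (g : LorentzianMetric E M) (x₀ : M) (q v w : E) :
    g.chartMetric x₀ q v w =
      g.val ((extChartAt 𝓘(ℝ, E) x₀).symm q) (chartVec x₀ q v) (chartVec x₀ q w) := rfl

lemma extChartAt_symm_mem_baseSet (x₀ : M) {q : E} (hq : q ∈ (extChartAt 𝓘(ℝ, E) x₀).target) :
    (extChartAt 𝓘(ℝ, E) x₀).symm q ∈
      (trivializationAt E (TangentSpace 𝓘(ℝ, E) (M := M)) x₀).baseSet := by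
  rw [TangentBundle.trivializationAt_baseSet, ← extChartAt_source 𝓘(ℝ, E) x₀]
  exact (extChartAt 𝓘(ℝ, E) x₀).map_target hq

lemma chartVec_chartField (T : (x : M) → TangentSpace 𝓘(ℝ, E) x) (x₀ : M) {q : E}
    (hq : q ∈ (extChartAt 𝓘(ℝ, E) x₀).target) :
    chartVec x₀ q (chartField T x₀ q) = T ((extChartAt 𝓘(ℝ, E) x₀).symm q) := by
  have hb := extChartAt_symm_mem_baseSet x₀ hq
  have h := (trivializationAt E (TangentSpace 𝓘(ℝ, E)) x₀).symmL_continuousLinearMapAt (R := ℝ) hb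
    (T ((extChartAt 𝓘(ℝ, E) x₀).symm q))
  rwa [Bundle.Trivialization.continuousLinearMapAt_apply,
    Bundle.Trivialization.coe_linearMapAt_of_mem _ hb] at h

lemma continuousOn_chartField {T : (x : M) → TangentSpace 𝓘(ℝ, E) x}
    (hT : Continuous (fun x ↦ (⟨x, T x⟩ : TangentBundle 𝓘(ℝ, E) M))) (x₀ : M) :
    ContinuousOn (chartField T x₀) (extChartAt 𝓘(ℝ, E) x₀).target := by
  have h1 := (trivializationAt E (TangentSpace 𝓘(ℝ, E) (M := M)) x₀).continuousOn
  have h2 := hT.comp_continuousOn (continuousOn_extChartAt_symm (I := 𝓘(ℝ, E)) x₀)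
  refine (h1.comp h2 fun q hq ↦ ?_).snd
  rw [Bundle.Trivialization.mem_source]
  exact extChartAt_symm_mem_baseSet x₀ hq

/-- In finite dimension it suffices to see that the components of the metric in the coordinate frame
are `C¹`. -/
lemma contDiffOn_chartMetric [FiniteDimensional ℝ E] (g : LorentzianMetric E M) (x₀ : M) :
    ContDiffOn ℝ 1 (g.chartMetric x₀) (extChartAt 𝓘(ℝ, E) x₀).target := by
  rw [contDiffOn_clm_apply]
  intro v
  rw [contDiffOn_clm_apply]
  intro w
  rw [← contMDiffOn_iff_contDiffOn]
  have hb : ContMDiffOn 𝓘(ℝ, E) 𝓘(ℝ, E) 1 (extChartAt 𝓘(ℝ, E) x₀).symm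
    (extChartAt 𝓘(ℝ, E) x₀).target := contMDiffOn_extChartAt_symm x₀
  have hv : ∀ v : E, ContMDiffOn 𝓘(ℝ, E) (𝓘(ℝ, E).prod 𝓘(ℝ, E)) 1
      (fun q ↦ Bundle.TotalSpace.mk' E (E := fun x : M ↦ TangentSpace 𝓘(ℝ, E) x)
        ((extChartAt 𝓘(ℝ, E) x₀).symm q) (chartVec x₀ q v)) (extChartAt 𝓘(ℝ, E) x₀).target := by
    intro v
    have h1 := (trivializationAt E (TangentSpace 𝓘(ℝ, E) (M := M)) x₀).contMDiffOn_symm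
      (n := 1) (IB := 𝓘(ℝ, E))
    have h2 : ContMDiffOn 𝓘(ℝ, E) (𝓘(ℝ, E).prod 𝓘(ℝ, E)) 1
      (fun q : E ↦ (((extChartAt 𝓘(ℝ, E) x₀).symm q, v) : M × E))
      (extChartAt 𝓘(ℝ, E) x₀).target := hb.prodMk contMDiffOn_const
    refine (h1.comp h2 fun q hq ↦ ?_).congr fun q hq ↦ ?_
    · rw [mem_preimage, Bundle.Trivialization.mem_target]
      exact extChartAt_symm_mem_baseSet x₀ hq
    · have hq' := extChartAt_symm_mem_baseSet x₀ hq
      simp only [Function.comp_apply, chartVec]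
      rw [Bundle.Trivialization.symmL_apply _ hq', ← Bundle.Trivialization.mk_symm _ hq']
  have hg := (g.contMDiff.of_le (n := ∞) (m := 1) (by exact_mod_cast le_top)).comp_contMDiffOn hb
  have := ContMDiffOn.clm_bundle_apply₂ (F₁ := E) (F₂ := E) (F₃ := ℝ)
    (E₁ := fun x : M ↦ TangentSpace 𝓘(ℝ, E) x) (E₂ := fun x : M ↦ TangentSpace 𝓘(ℝ, E) x)
    (E₃ := Bundle.Trivial M ℝ) hg (hv v) (hv w)
  intro q hq
  have := this q hq
  simp only [Bundle.contMDiffWithinAt_totalSpace] at this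
  exact this.2

/-- The velocity of a curve given in coordinates has the coordinate derivative as its components. -/
lemma mfderivWithin_extChartAt_symm_comp (x₀ : M) {σ : ℝ → E} {s : Set ℝ} {t : ℝ}
    (hs : UniqueDiffWithinAt ℝ s t) (hσ : DifferentiableWithinAt ℝ σ s t)
    (ht : σ t ∈ (extChartAt 𝓘(ℝ, E) x₀).target) :
    mfderivWithin 𝓘(ℝ, ℝ) 𝓘(ℝ, E) ((extChartAt 𝓘(ℝ, E) x₀).symm ∘ σ) s t (1 : ℝ) =
      chartVec x₀ (σ t) (derivWithin σ s t) := by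
  have h1 := mdifferentiableWithinAt_extChartAt_symm (I := 𝓘(ℝ, E)) ht
  rw [mfderivWithin_comp t h1 hσ.mdifferentiableWithinAt (by simp) hs.uniqueMDiffWithinAt]
  have h2 := (extChartAt 𝓘(ℝ, E) x₀).map_target ht
  have h3 := TangentBundle.symmL_trivializationAt (I := 𝓘(ℝ, E)) (𝕜 := ℝ)
    (x₀ := x₀) (x := (extChartAt 𝓘(ℝ, E) x₀).symm (σ t)) (by simpa using h2)
  rw [(extChartAt 𝓘(ℝ, E) x₀).right_inv ht] at h3
  rw [chartVec, h3, mfderivWithin_eq_fderivWithin]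
  rfl

end LorentzianMetric

/-! ### Piecewise `C¹` curves -/

section
variable {E : Type*} [NormedAddCommGroup E] [NormedSpace ℝ E]
  {M : Type*} [TopologicalSpace M] [ChartedSpace E M]

/-- `γ` is a `C¹` curve on `[a, b]`, `a < b`, with all tangent vectors in `C`: one piece of a curve
as in `IsPiecewiseC1CurveIn`. -/
def IsC1ArcIn (C : (x : M) → TangentSpace 𝓘(ℝ, E) x → Prop) (γ : ℝ → M) (a b : ℝ) : Prop :=
  a < b ∧ ContMDiffOn 𝓘(ℝ, ℝ) 𝓘(ℝ, E) 1 γ (Icc a b) ∧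
    ∀ s ∈ Icc a b, C (γ s) (mfderivWithin 𝓘(ℝ, ℝ) 𝓘(ℝ, E) γ (Icc a b) s (1 : ℝ))

variable {C : (x : M) → TangentSpace 𝓘(ℝ, E) x → Prop} {γ γ' : ℝ → M} {a b c d s : ℝ} {x y z : M}

/-- Transport of a statement about a tangent vector along an equality of base points. The tangent
spaces at both points are copies of `E`, in which the vectors are compared. -/
lemma tangent_pred_congr {p q : M} {v : TangentSpace 𝓘(ℝ, E) p} {w : TangentSpace 𝓘(ℝ, E) q}
    (hpq : p = q) (hvw : (show E from v) = (show E from w)) (h : C p v) : C q w := by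
  subst hpq
  have : v = w := hvw
  rwa [← this]

lemma IsC1ArcIn.congr (h : IsC1ArcIn C γ a b) (hγ : EqOn γ' γ (Icc a b)) :
    IsC1ArcIn C γ' a b := by
  refine ⟨h.1, h.2.1.congr hγ, fun s hs ↦ ?_⟩
  refine tangent_pred_congr (hγ hs).symm ?_ (h.2.2 s hs)
  have := mfderivWithin_congr_of_mem (I := 𝓘(ℝ, ℝ)) (I' := 𝓘(ℝ, E)) hγ hs
  exact (congrArg (fun L : ℝ →L[ℝ] E ↦ L 1) this).symm

lemma IsC1ArcIn.mono (h : IsC1ArcIn C γ a b) (hac : a ≤ c) (hcd : c < d) (hdb : d ≤ b) :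
    IsC1ArcIn C γ c d := by
  have hsub : Icc c d ⊆ Icc a b := Icc_subset_Icc hac hdb
  refine ⟨hcd, h.2.1.mono hsub, fun s hs ↦ ?_⟩
  have := mfderivWithin_subset hsub (uniqueDiffOn_Icc hcd s hs).uniqueMDiffWithinAt
    (h.2.1.mdifferentiableOn one_ne_zero s (hsub hs))
  rw [this]
  exact h.2.2 s (hsub hs)

lemma IsC1ArcIn.comp_add_const (h : IsC1ArcIn C γ a b) (k : ℝ) :
    IsC1ArcIn C (fun t ↦ γ (t + k)) (a - k) (b - k) := by
  have hmaps : MapsTo (fun t ↦ t + k) (Icc (a - k) (b - k)) (Icc a b) := fun t ht ↦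
    ⟨by linarith [ht.1], by linarith [ht.2]⟩
  have hlt : a - k < b - k := by linarith [h.1]
  have hsm : ContMDiff 𝓘(ℝ, ℝ) 𝓘(ℝ, ℝ) 1 (fun t : ℝ ↦ t + k) :=
    (contDiff_id.add contDiff_const).contMDiff
  refine ⟨hlt, h.2.1.comp hsm.contMDiffOn hmaps, fun s hs ↦ ?_⟩
  have hu := (uniqueDiffOn_Icc hlt s hs)
  have h1 := mfderivWithin_comp (I := 𝓘(ℝ, ℝ)) (I' := 𝓘(ℝ, ℝ)) (I'' := 𝓘(ℝ, E)) s
    (g := γ) (f := fun t ↦ t + k) (h.2.1.mdifferentiableOn one_ne_zero _ (hmaps hs))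
    ((hsm.mdifferentiable one_ne_zero s).mdifferentiableWithinAt) hmaps hu.uniqueMDiffWithinAt
  have h2 : mfderivWithin 𝓘(ℝ, ℝ) 𝓘(ℝ, ℝ) (fun t : ℝ ↦ t + k) (Icc (a - k) (b - k)) s (1 : ℝ) =
      (1 : ℝ) := by
    rw [mfderivWithin_eq_fderivWithin]
    have h3 : HasDerivWithinAt (fun t : ℝ ↦ t + k) 1 (Icc (a - k) (b - k)) s :=
      ((hasDerivAt_id s).add_const k).hasDerivWithinAt
    exact h3.derivWithin hu
  refine tangent_pred_congr rfl ?_ (h.2.2 (s + k) (hmaps hs))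
  change _ = mfderivWithin 𝓘(ℝ, ℝ) 𝓘(ℝ, E) (γ ∘ fun t ↦ t + k) (Icc (a - k) (b - k)) s (1 : ℝ)
  rw [h1]
  change _ = mfderivWithin 𝓘(ℝ, ℝ) 𝓘(ℝ, E) γ (Icc a b) (s + k)
    (mfderivWithin 𝓘(ℝ, ℝ) 𝓘(ℝ, ℝ) (fun t : ℝ ↦ t + k) (Icc (a - k) (b - k)) s (1 : ℝ))
  rw [h2]

lemma IsC1ArcIn.isPiecewise (h : IsC1ArcIn C γ a b) :
    IsPiecewiseC1CurveIn C γ a b (γ a) (γ b) :=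
  ⟨h.1, rfl, rfl, 1, fun i ↦ if i = 0 then a else b, by simp, by simp, fun i hi ↦ by
    obtain rfl : i = 0 := by omega
    change IsC1ArcIn C γ _ _
    simpa using h⟩

lemma Icc_subset_Icc_of_forall_lt_succ {n : ℕ} {t : ℕ → ℝ} (ht : ∀ i < n, t i < t (i + 1)) {i : ℕ}
    (hi : i < n) : Icc (t i) (t (i + 1)) ⊆ Icc (t 0) (t n) := by
  have hmono : ∀ j k : ℕ, j + k ≤ n → t j ≤ t (j + k) := fun j k ↦ by
    induction k with
    | zero => simp
    | succ k ih => intro h; exact (ih (by omega)).trans (ht (j + k) (by omega)).le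
  refine Icc_subset_Icc ?_ ?_
  · simpa using hmono 0 i (by omega)
  · have := hmono (i + 1) (n - (i + 1)) (by omega)
    rwa [Nat.add_sub_cancel' (by omega)] at this

/-- Two curves are joined end to end. The second one keeps its parametrization, so that its arc
length is visibly a part of the arc length of the concatenation. -/
lemma IsPiecewiseC1CurveIn.concat (h₁ : IsPiecewiseC1CurveIn C γ a b x y)
    (h₂ : IsPiecewiseC1CurveIn C γ' c d y z) :
    ∃ (δ : ℝ → M) (e : ℝ), e < c ∧ IsPiecewiseC1CurveIn C δ e d x z ∧ EqOn δ γ' (Ici c) := by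
  obtain ⟨hab, hx, hy, n, t, ht0, htn, ht⟩ := h₁
  obtain ⟨hcd, hy', hz, m, u, hu0, hum, hu⟩ := h₂
  set k := b - c with hk
  set δ : ℝ → M := fun s ↦ if s < c then γ (s + k) else γ' s with hδ
  have hright : EqOn δ γ' (Ici c) := fun s hs ↦ if_neg (not_lt.2 hs)
  have hleft : EqOn δ (fun s ↦ γ (s + k)) (Iic c) := fun s hs ↦ by
    rcases (show s ≤ c from hs).lt_or_eq with h | rfl
    · exact if_pos h
    · rw [hright self_mem_Ici, hy']
      simp [hk, hy]
  have hm : 0 < m := by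
    rcases Nat.eq_zero_or_pos m with rfl | h
    · rw [hu0] at hum; exact absurd hum hcd.ne
    · exact h
  refine ⟨δ, a - k, by linarith, ⟨by linarith, ?_, ?_, n + m,
    fun i ↦ if i < n then t i - k else u (i - n), ?_, ?_, ?_⟩, hright⟩
  · rw [hleft (show a - k ≤ c by linarith)]; simpa using hx
  · rw [hright hcd.le, hz]
  · rcases Nat.eq_zero_or_pos n with rfl | h
    · rw [ht0] at htn; exact absurd htn hab.ne
    · simp [h, ht0]
  · simp [hum]
  · intro i hi
    change IsC1ArcIn C δ _ _
    by_cases hin : i < n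
    · have harc : IsC1ArcIn C γ (t i) (t (i + 1)) := ht i hin
      have hsub := Icc_subset_Icc_of_forall_lt_succ (fun i hi ↦ (ht i hi).1) hin
      rw [ht0, htn] at hsub
      have harc' : IsC1ArcIn C δ (t i - k) (t (i + 1) - k) := by
        refine (harc.comp_add_const k).congr fun s hs ↦ hleft ?_
        have := (hsub ⟨harc.1.le, le_rfl⟩).2
        exact hs.2.trans (by linarith)
      by_cases hin' : i + 1 < n
      · simpa only [if_pos hin, if_pos hin'] using harc'
      · obtain rfl : i + 1 = n := by omega
        have : t (i + 1) - k = u 0 := by rw [htn, hu0, hk]; ring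
        simpa [this] using harc'
    · have harc : IsC1ArcIn C γ' (u (i - n)) (u (i - n + 1)) := hu (i - n) (by omega)
      have hsub := Icc_subset_Icc_of_forall_lt_succ (fun i hi ↦ (hu i hi).1)
        (show i - n < m by omega)
      rw [hu0, hum] at hsub
      have harc' := harc.congr fun s hs ↦ hright (hsub hs).1
      have e : i + 1 - n = i - n + 1 := by omega
      simpa only [if_neg hin, if_neg (show ¬ i + 1 < n by omega), e] using harc'

/-- Each parameter `s` has a neighbourhood in `[a, b]` of the form `[c, d]` whose image lies in the
chart at `γ s`. -/
lemma IsC1ArcIn.exists_mapsTo_chart (h : IsC1ArcIn C γ a b) (hs : s ∈ Icc a b) :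
    ∃ c d, a ≤ c ∧ c < d ∧ d ≤ b ∧ s ∈ Icc c d ∧ IsC1ArcIn C γ c d ∧
      MapsTo γ (Icc c d) (extChartAt 𝓘(ℝ, E) (γ s)).source ∧
      ∃ τ > 0, Icc a b ∩ Ioo (s - τ) (s + τ) ⊆ Icc c d := by
  have h1 : γ ⁻¹' (extChartAt 𝓘(ℝ, E) (γ s)).source ∈ 𝓝[Icc a b] s :=
    (h.2.1.continuousOn s hs).preimage_mem_nhdsWithin (extChartAt_source_mem_nhds (γ s))
  obtain ⟨τ, hτ, hsub⟩ := Metric.mem_nhdsWithin_iff.1 h1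
  have hab := h.1
  have hlt : max a (s - τ / 2) < min b (s + τ / 2) := by
    rw [max_lt_iff, lt_min_iff, lt_min_iff]
    exact ⟨⟨hab, by linarith [hs.1]⟩, by linarith [hs.2], by linarith⟩
  refine ⟨max a (s - τ / 2), min b (s + τ / 2), le_max_left _ _, hlt, min_le_left _ _,
    ⟨max_le hs.1 (by linarith), le_min hs.2 (by linarith)⟩,
    h.mono (le_max_left _ _) hlt (min_le_left _ _), fun t ht ↦ hsub ⟨?_, ?_⟩, τ / 2, by positivity,
    fun t ht ↦ ⟨max_le ht.1.1 ht.2.1.le, le_min ht.1.2 ht.2.2.le⟩⟩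
  · rw [Metric.mem_ball, Real.dist_eq, abs_lt]
    constructor <;> linarith [(max_le_iff.1 ht.1).2, (le_min_iff.1 ht.2).2]
  · exact ⟨(max_le_iff.1 ht.1).1, (le_min_iff.1 ht.2).1⟩

/-- A piecewise `C¹` curve that ends at `y` has a final arc that starts in a given neighbourhood
of `y`. -/
lemma IsPiecewiseC1CurveIn.exists_final_arc (h : IsPiecewiseC1CurveIn C γ a b x y) {U : Set M}
    (hU : U ∈ 𝓝 y) : ∃ c, γ c ∈ U ∧ IsC1ArcIn C γ c b := by
  obtain ⟨hab, rfl, rfl, n, t, rfl, rfl, ht⟩ := h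
  obtain _ | n := n
  · exact absurd rfl hab.ne
  have harc : IsC1ArcIn C γ (t n) (t (n + 1)) := ht n n.lt_succ_self
  have hlt := harc.1
  have hcont := (harc.2.1.continuousOn _ (right_mem_Icc.2 hlt.le)).mono Ico_subset_Icc_self
  have hne : (𝓝[Ico (t n) (t (n + 1))] (t (n + 1))).NeBot := by
    rw [nhdsWithin_Ico_eq_nhdsLT hlt]
    infer_instance
  obtain ⟨c, hcU, hc⟩ := ((hcont.eventually hU).and self_mem_nhdsWithin).exists
  exact ⟨c, hcU, harc.mono hc.1 hc.2 le_rfl⟩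

end

/-! ### Arcs in charts -/

section
variable {E : Type*} [NormedAddCommGroup E] [NormedSpace ℝ E]
  {M : Type*} [TopologicalSpace M] [ChartedSpace E M] [IsManifold 𝓘(ℝ, E) ∞ M]
  {C : (x : M) → TangentSpace 𝓘(ℝ, E) x → Prop} {γ : ℝ → M} {c d : ℝ}

open LorentzianMetric in
/-- For a curve given in coordinates, membership of the tangent vectors in `C` can be tested on the
coordinate derivative. -/
lemma isC1ArcIn_extChartAt_symm_comp_iff (x₀ : M) {σ : ℝ → E} (hcd : c < d)
    (hσ : ContDiffOn ℝ 1 σ (Icc c d))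
    (hmaps : MapsTo σ (Icc c d) (extChartAt 𝓘(ℝ, E) x₀).target) :
    IsC1ArcIn C ((extChartAt 𝓘(ℝ, E) x₀).symm ∘ σ) c d ↔ ∀ t ∈ Icc c d,
      C ((extChartAt 𝓘(ℝ, E) x₀).symm (σ t)) (chartVec x₀ (σ t) (derivWithin σ (Icc c d) t)) := by
  have hd : ∀ t ∈ Icc c d, _ := fun t ht ↦ mfderivWithin_extChartAt_symm_comp x₀
    (uniqueDiffOn_Icc hcd t ht) (hσ.differentiableOn one_ne_zero t ht) (hmaps ht)
  constructor
  · intro h t ht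
    rw [← hd t ht]
    exact h.2.2 t ht
  · intro h
    refine ⟨hcd, (contMDiffOn_extChartAt_symm x₀).comp hσ.contMDiffOn hmaps, fun t ht ↦ ?_⟩
    rw [hd t ht]
    exact h t ht

lemma IsC1ArcIn.contDiffOn_extChartAt_comp (h : IsC1ArcIn C γ c d) {x₀ : M}
    (hmaps : MapsTo γ (Icc c d) (extChartAt 𝓘(ℝ, E) x₀).source) :
    ContDiffOn ℝ 1 (extChartAt 𝓘(ℝ, E) x₀ ∘ γ) (Icc c d) := by
  rw [← contMDiffOn_iff_contDiffOn]
  refine contMDiffOn_extChartAt.comp h.2.1 ?_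
  rwa [extChartAt_source] at hmaps

open LorentzianMetric in
lemma IsC1ArcIn.chart_tangent_mem (h : IsC1ArcIn C γ c d) {x₀ : M}
    (hmaps : MapsTo γ (Icc c d) (extChartAt 𝓘(ℝ, E) x₀).source) :
    ∀ t ∈ Icc c d, C ((extChartAt 𝓘(ℝ, E) x₀).symm ((extChartAt 𝓘(ℝ, E) x₀ ∘ γ) t))
      (chartVec x₀ ((extChartAt 𝓘(ℝ, E) x₀ ∘ γ) t)
        (derivWithin (extChartAt 𝓘(ℝ, E) x₀ ∘ γ) (Icc c d) t)) := by
  refine (isC1ArcIn_extChartAt_symm_comp_iff x₀ h.1 (h.contDiffOn_extChartAt_comp hmaps)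
    fun t ht ↦ (extChartAt 𝓘(ℝ, E) x₀).map_source (hmaps ht)).1 (h.congr fun t ht ↦ ?_)
  exact (extChartAt 𝓘(ℝ, E) x₀).left_inv (hmaps ht)

end

/-! ### Approximate chronological relation -/

namespace LorentzianMetric

variable {E : Type*} [NormedAddCommGroup E] [NormedSpace ℝ E]
  {M : Type*} [TopologicalSpace M] [ChartedSpace E M] [IsManifold 𝓘(ℝ, E) ∞ M]
  {g : LorentzianMetric E M} {T : (x : M) → TangentSpace 𝓘(ℝ, E) x}

lemma mem_chronFuture_trans {x y z : M} (hxy : y ∈ g.chronFuture T x)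
    (hyz : z ∈ g.chronFuture T y) : z ∈ g.chronFuture T x := by
  obtain ⟨γ, a, b, h⟩ := hxy
  obtain ⟨γ', c, d, h'⟩ := hyz
  obtain ⟨δ, e, -, hδ, -⟩ := h.concat h'
  exact ⟨δ, e, d, hδ⟩

/-- Every point near `p` has points arbitrarily close to `q` in its chronological future. Causal
curves join pairs of points in this relation; unlike `q ∈ closure (I⁺(p))` it is visibly
transitive. -/
def ApproxChron (g : LorentzianMetric E M) (T : (x : M) → TangentSpace 𝓘(ℝ, E) x) (p q : M) :
    Prop :=
  ∀ W ∈ 𝓝 q, ∀ᶠ p' in 𝓝 p, ∃ q' ∈ W, q' ∈ g.chronFuture T p'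

lemma ApproxChron.trans {p q r : M} (hpq : g.ApproxChron T p q) (hqr : g.ApproxChron T q r) :
    g.ApproxChron T p r := by
  intro W hW
  filter_upwards [hpq _ (hqr W hW)] with p' hp'
  obtain ⟨q', ⟨r', hr', hr⟩, hq⟩ := hp'
  exact ⟨r', hr', mem_chronFuture_trans hq hr⟩

lemma ApproxChron.mem_closure {p q : M} (h : g.ApproxChron T p q) :
    q ∈ closure (g.chronFuture T p) :=
  mem_closure_iff_nhds.2 fun W hW ↦
    let ⟨q', hq', hq⟩ := (h W hW).self_of_nhds
    ⟨q', hq', hq⟩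

/-! ### Conformal invariance of the chronological future -/

/-- The factor `Ω²` has no zeros, since `h` takes a negative value at each point. -/
lemma ConformallyRelated.futureTimelike_eq {h : LorentzianMetric E M}
    (hgh : g.ConformallyRelated h) : h.FutureTimelike T = g.FutureTimelike T := by
  obtain ⟨Ω, hΩ⟩ := hgh
  funext x v
  have h0 : 0 < Ω x ^ 2 := by
    obtain ⟨w, hw, -⟩ := h.signature x
    rw [hΩ] at hw
    refine (sq_nonneg (Ω x)).lt_of_ne fun h0 ↦ ?_
    rw [← h0, zero_mul] at hw
    exact hw.false
  simp only [FutureTimelike, hΩ, mul_neg_iff, h0, h0.not_gt, true_and, false_and, or_false]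

lemma ConformallyRelated.chronFuture_eq {h : LorentzianMetric E M}
    (hgh : g.ConformallyRelated h) : h.chronFuture T = g.chronFuture T := by
  funext x
  simp only [chronFuture, hgh.futureTimelike_eq]

/-! ### Lower bounds for the Lorentzian distance -/

variable {γ : ℝ → M} {a b s : ℝ}

lemma FutureTimelike.futureCausal {x : M} {v : TangentSpace 𝓘(ℝ, E) x}
    (h : g.FutureTimelike T x v) : g.FutureCausal T x v :=
  ⟨h.1.le, h.2⟩

lemma isPiecewiseC1CurveIn_futureCausal {x y : M}
    (h : IsPiecewiseC1CurveIn (g.FutureTimelike T) γ a b x y) :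
    IsPiecewiseC1CurveIn (g.FutureCausal T) γ a b x y := by
  obtain ⟨hab, hx, hy, n, t, h0, hn, ht⟩ := h
  exact ⟨hab, hx, hy, n, t, h0, hn, fun i hi ↦
    ⟨(ht i hi).1, (ht i hi).2.1, fun s hs ↦ ((ht i hi).2.2 s hs).futureCausal⟩⟩

/-- A reverse triangle inequality in which the length of the first curve is dropped. -/
lemma arcLength_le_lorentzDist_of_mem_chronFuture {x y z : M} (hxy : y ∈ g.chronFuture T x)
    (h : IsPiecewiseC1CurveIn (g.FutureTimelike T) γ a b y z) :
    g.arcLength γ a b ≤ g.lorentzDist T x z := by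
  obtain ⟨γ₀, a₀, b₀, h₀⟩ := hxy
  obtain ⟨δ, e, hea, hδ, heq⟩ := h₀.concat h
  have hle : g.arcLength δ e b ≤ g.lorentzDist T x z :=
    le_iSup_of_le δ <| le_iSup_of_le e <| le_iSup_of_le b <|
      le_iSup_of_le (isPiecewiseC1CurveIn_futureCausal hδ) le_rfl
  refine le_trans ?_ hle
  have hpt : ∀ t ∈ Ioo a b, ENNReal.ofReal √(-(g.val (γ t) (mfderiv 𝓘(ℝ, ℝ) 𝓘(ℝ, E) γ t (1 : ℝ))
      (mfderiv 𝓘(ℝ, ℝ) 𝓘(ℝ, E) γ t (1 : ℝ)))) =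
      ENNReal.ofReal √(-(g.val (δ t) (mfderiv 𝓘(ℝ, ℝ) 𝓘(ℝ, E) δ t (1 : ℝ))
      (mfderiv 𝓘(ℝ, ℝ) 𝓘(ℝ, E) δ t (1 : ℝ)))) := by
    intro t ht
    have hloc : δ =ᶠ[𝓝 t] γ := by
      filter_upwards [Ioi_mem_nhds ht.1] with r hr
      exact heq (mem_Ici.2 (le_of_lt hr))
    congr 3
    refine tangent_pred_congr
      (C := fun p w ↦ g.val p w w = g.val (δ t) (mfderiv 𝓘(ℝ, ℝ) 𝓘(ℝ, E) δ t (1 : ℝ))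
        (mfderiv 𝓘(ℝ, ℝ) 𝓘(ℝ, E) δ t (1 : ℝ))) hloc.eq_of_nhds ?_ rfl
    exact congrArg (fun L : ℝ →L[ℝ] E ↦ L 1) hloc.mfderiv_eq
  calc g.arcLength γ a b = ∫⁻ t in Ioo a b, ENNReal.ofReal √(-(g.val (γ t)
          (mfderiv 𝓘(ℝ, ℝ) 𝓘(ℝ, E) γ t (1 : ℝ)) (mfderiv 𝓘(ℝ, ℝ) 𝓘(ℝ, E) γ t (1 : ℝ)))) :=
        setLIntegral_congr Ioo_ae_eq_Icc.symm
    _ = ∫⁻ t in Ioo a b, ENNReal.ofReal √(-(g.val (δ t)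
          (mfderiv 𝓘(ℝ, ℝ) 𝓘(ℝ, E) δ t (1 : ℝ)) (mfderiv 𝓘(ℝ, ℝ) 𝓘(ℝ, E) δ t (1 : ℝ)))) :=
        setLIntegral_congr_fun measurableSet_Ioo hpt
    _ ≤ g.arcLength δ e b :=
        lintegral_mono_set (Ioo_subset_Icc_self.trans (Icc_subset_Icc hea.le le_rfl))

/-! ### Causal curves are limits of timelike curves -/

variable [FiniteDimensional ℝ E]

/-- The local form of the statement that causal curves join points related by `ApproxChron`: the
chart version is `exists_timelike_perturbation`. -/
lemma exists_approxChron_of_isC1ArcIn (hT : g.IsTimeOrientation T)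
    (h : IsC1ArcIn (g.FutureCausal T) γ a b) (hs : s ∈ Icc a b) :
    ∃ τ > 0, ∀ s₁ s₂, s₁ < s₂ → a ≤ s₁ → s₂ ≤ b → s - τ < s₁ → s₂ < s + τ →
      g.ApproxChron T (γ s₁) (γ s₂) := by
  obtain ⟨c, d, -, hcd, -, hscd, harc, hmaps, τ₀, hτ₀, hτsub⟩ := h.exists_mapsTo_chart hs
  set x₀ := γ s with hx₀
  set φ := extChartAt 𝓘(ℝ, E) x₀ with hφ
  have hσ := harc.contDiffOn_extChartAt_comp hmaps
  have htan := harc.chart_tangent_mem hmaps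
  rw [← hφ] at hσ htan
  have hσΩ : MapsTo (φ ∘ γ) (Icc c d) φ.target := fun t ht ↦ φ.map_source (hmaps ht)
  obtain ⟨τ, hτ, hpert⟩ := exists_timelike_perturbation (isOpen_extChartAt_target x₀)
    (g.contDiffOn_chartMetric x₀) (fun q _ v w ↦ g.symm _ _ _)
    (continuousOn_chartField hT.continuous x₀)
    (fun q hq ↦ by
      rw [chartMetric_apply, chartVec_chartField T x₀ hq]
      exact hT.timelike _) hcd hσ hσΩ
    (fun t ht ↦ by
      simp only [chartMetric_apply]
      rw [chartVec_chartField T x₀ (hσΩ ht)]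
      exact htan t ht) hscd
  refine ⟨min τ τ₀, lt_min hτ hτ₀, fun s₁ s₂ hlt has hsb h₁ h₂ W hW ↦ ?_⟩
  have e₁ := min_le_left τ τ₀
  have e₂ := min_le_right τ τ₀
  have hs₁ : s₁ ∈ Icc c d := hτsub ⟨⟨has, by linarith⟩, by linarith, by linarith⟩
  have hs₂ : s₂ ∈ Icc c d := hτsub ⟨⟨by linarith, hsb⟩, by linarith, by linarith⟩
  have hW' : φ.symm ⁻¹' W ∈ 𝓝 ((φ ∘ γ) s₂) := by
    refine (continuousAt_extChartAt_symm' (hmaps hs₂)).preimage_mem_nhds ?_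
    rwa [← hφ, φ.left_inv (hmaps hs₂)]
  have hev := (continuousAt_extChartAt' (hmaps hs₁)).eventually
    (hpert s₁ s₂ hlt hs₁.1 hs₂.2 (by linarith) (by linarith) _ hW')
  filter_upwards [hev, extChartAt_source_mem_nhds' (hmaps hs₁)] with p hp hpsrc
  obtain ⟨ρ, hρ, hρ₁, hρ₂, hρt⟩ := hp
  have hρarc : IsC1ArcIn (g.FutureTimelike T) (φ.symm ∘ ρ) s₁ s₂ := by
    refine (isC1ArcIn_extChartAt_symm_comp_iff x₀ hlt hρ fun t ht ↦ (hρt t ht).1).2 fun t ht ↦ ?_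
    obtain ⟨hΩ, h1, h2⟩ := hρt t ht
    rw [chartMetric_apply] at h1 h2
    rw [chartVec_chartField T x₀ hΩ] at h2
    exact ⟨h1, h2⟩
  refine ⟨φ.symm (ρ s₂), hρ₂, φ.symm ∘ ρ, s₁, s₂, ?_⟩
  have := hρarc.isPiecewise
  rwa [Function.comp_apply, hρ₁, φ.left_inv hpsrc] at this

/-- The local statement `exists_approxChron_of_isC1ArcIn` is applied on the members of a
sufficiently fine partition of `[a, b]`. -/
lemma approxChron_of_isC1ArcIn (hT : g.IsTimeOrientation T)
    (h : IsC1ArcIn (g.FutureCausal T) γ a b) : g.ApproxChron T (γ a) (γ b) := by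
  choose τ hτ hloc using fun s : Icc a b ↦ exists_approxChron_of_isC1ArcIn hT h s.2
  obtain ⟨t, ht0, hmono, ⟨m, hm⟩, hsub⟩ := exists_monotone_Icc_subset_open_cover_Icc h.1.le
    (c := fun s : Icc a b ↦ {r : Icc a b | (s : ℝ) - τ s < r ∧ (r : ℝ) < s + τ s})
    (fun s ↦ (isOpen_lt continuous_const continuous_subtype_val).inter
      (isOpen_lt continuous_subtype_val continuous_const))
    (fun s _ ↦ mem_iUnion.2 ⟨s, by
      have := hτ s
      constructor <;> linarith⟩)
  -- The partition need not be strictly increasing, and `ApproxChron` is not reflexive a priori.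
  have hstep : ∀ n, (a = t n) ∨ g.ApproxChron T (γ a) (γ (t n)) := by
    intro n
    induction n with
    | zero => exact Or.inl ht0.symm
    | succ n ih =>
      have hle : t n ≤ t (n + 1) := hmono n.le_succ
      rcases hle.eq_or_lt with heq | hlt
      · rwa [← heq]
      obtain ⟨i, hi⟩ := hsub n
      have h1 := hloc i (t n) (t (n + 1)) hlt (t n).2.1 (t (n + 1)).2.2
        (hi ⟨le_rfl, hle⟩).1 (hi ⟨hle, le_rfl⟩).2
      rcases ih with ih | ih
      · rw [← ih] at h1
        exact Or.inr h1
      · exact Or.inr (ih.trans h1)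
  rcases hstep m with h1 | h1
  · rw [hm m le_rfl] at h1
    exact absurd h1 h.1.ne
  · rwa [hm m le_rfl] at h1

/-- The causal future is contained in the closure of the chronological future. -/
lemma mem_closure_chronFuture (hT : g.IsTimeOrientation T) {x y : M}
    (h : IsPiecewiseC1CurveIn (g.FutureCausal T) γ a b x y) :
    y ∈ closure (g.chronFuture T x) := by
  obtain ⟨hab, rfl, rfl, n, t, rfl, rfl, ht⟩ := h
  have hstep : ∀ k, 0 < k → k ≤ n → g.ApproxChron T (γ (t 0)) (γ (t k)) := by
    intro k hk hkn
    induction k, hk using Nat.le_induction with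
    | base => exact approxChron_of_isC1ArcIn hT (ht 0 hkn)
    | succ k hk ih =>
      exact (ih (by omega)).trans (approxChron_of_isC1ArcIn hT (ht k (by omega)))
  refine (hstep n (Nat.pos_of_ne_zero ?_) le_rfl).mem_closure
  rintro rfl
  exact hab.false

/-! ### Positivity of length and discontinuity of the distance -/

/-- Only a neighbourhood of the initial point is used: there the speed is continuous in a chart and
so has a positive lower bound. -/
lemma arcLength_pos_of_isC1ArcIn (h : IsC1ArcIn (g.FutureTimelike T) γ a b) :
    0 < g.arcLength γ a b := by
  obtain ⟨c, d, hac, hcd, hdb, -, harc, hmaps, -⟩ :=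
    h.exists_mapsTo_chart (left_mem_Icc.2 h.1.le)
  set x₀ := γ a with hx₀
  set φ := extChartAt 𝓘(ℝ, E) x₀ with hφ
  have hσ := harc.contDiffOn_extChartAt_comp hmaps
  have htan := harc.chart_tangent_mem hmaps
  rw [← hφ] at hσ htan
  have hσΩ : MapsTo (φ ∘ γ) (Icc c d) φ.target := fun t ht ↦ φ.map_source (hmaps ht)
  set v := derivWithin (φ ∘ γ) (Icc c d) with hv
  have hvc : ContinuousOn v (Icc c d) :=
    hσ.continuousOn_derivWithin (uniqueDiffOn_Icc hcd) le_rfl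
  have hF : ContinuousOn (fun t ↦ -g.chartMetric x₀ ((φ ∘ γ) t) (v t) (v t)) (Icc c d) :=
    ((((g.contDiffOn_chartMetric x₀).continuousOn.comp hσ.continuousOn hσΩ).clm_apply
      hvc).clm_apply hvc).neg
  obtain ⟨t₀, ht₀, hmin⟩ := isCompact_Icc.exists_isMinOn (nonempty_Icc.2 hcd.le) hF
  set m := -g.chartMetric x₀ ((φ ∘ γ) t₀) (v t₀) (v t₀) with hm
  have hmpos : 0 < m := by
    have := (htan t₀ ht₀).1
    rw [hm, chartMetric_apply]
    linarith
  have hspeed : ∀ t ∈ Ioo c d, m ≤ -(g.val (γ t) (mfderiv 𝓘(ℝ, ℝ) 𝓘(ℝ, E) γ t (1 : ℝ))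
      (mfderiv 𝓘(ℝ, ℝ) 𝓘(ℝ, E) γ t (1 : ℝ))) := by
    intro t ht
    have ht' := Ioo_subset_Icc_self ht
    have hmem : Icc c d ∈ 𝓝 t := Icc_mem_nhds ht.1 ht.2
    have hle : m ≤ -g.chartMetric x₀ ((φ ∘ γ) t) (v t) (v t) := hmin ht'
    refine hle.trans (le_of_eq ?_)
    rw [chartMetric_apply, neg_inj]
    have hd := mfderivWithin_extChartAt_symm_comp x₀ (uniqueDiffOn_Icc hcd t ht')
      (hσ.differentiableOn one_ne_zero t ht') (hσΩ ht')
    rw [← hφ, ← hv, mfderivWithin_of_mem_nhds hmem] at hd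
    have hloc : φ.symm ∘ φ ∘ γ =ᶠ[𝓝 t] γ := by
      filter_upwards [hmem] with r hr
      exact φ.left_inv (hmaps hr)
    refine tangent_pred_congr
      (C := fun p w ↦ g.val p w w = g.val (γ t) (mfderiv 𝓘(ℝ, ℝ) 𝓘(ℝ, E) γ t (1 : ℝ))
        (mfderiv 𝓘(ℝ, ℝ) 𝓘(ℝ, E) γ t (1 : ℝ))) (φ.left_inv (hmaps ht')).symm ?_ rfl
    refine Eq.trans ?_ hd
    exact (congrArg (fun L : ℝ →L[ℝ] E ↦ L 1) hloc.mfderiv_eq).symm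
  calc (0 : ℝ≥0∞) < ENNReal.ofReal √m * volume (Ioo c d) := by
        rw [Real.volume_Ioo]
        exact ENNReal.mul_pos (by simpa using hmpos) (by simpa using hcd)
    _ = ∫⁻ _ in Ioo c d, ENNReal.ofReal √m := (setLIntegral_const _ _).symm
    _ ≤ ∫⁻ t in Ioo c d, ENNReal.ofReal √(-(g.val (γ t) (mfderiv 𝓘(ℝ, ℝ) 𝓘(ℝ, E) γ t (1 : ℝ))
          (mfderiv 𝓘(ℝ, ℝ) 𝓘(ℝ, E) γ t (1 : ℝ)))) :=
        setLIntegral_mono' measurableSet_Ioo fun t ht ↦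
          ENNReal.ofReal_le_ofReal (Real.sqrt_le_sqrt (hspeed t ht))
    _ ≤ g.arcLength γ a b :=
        lintegral_mono_set (Ioo_subset_Icc_self.trans (Icc_subset_Icc hac hdb))

/-- If `Miss⁺(x) ≠ ∅`, then the function `d(·, z)` is discontinuous at `x` for each
`z ∈ Miss⁺(x)`. -/
theorem not_continuous_lorentzDist (hT : g.IsTimeOrientation T) {x : M} {u : ℕ → M}
    (hu : g.IsFutureDirectedSeqTo T u x) (hne : (g.missFuture T u x).Nonempty) :
    ¬ Continuous fun p : M × M ↦ g.lorentzDist T p.1 p.2 := by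
  intro hcont
  obtain ⟨z, hz⟩ := hne
  have hopen : IsOpen (g.missFuture T u x) := isOpen_interior
  have hsub : g.missFuture T u x ⊆ (⋂ i, g.chronFuture T (u i)) \ g.chronFuture T x :=
    interior_subset
  have hzero : g.lorentzDist T x z = 0 := by
    rw [lorentzDist]
    simp only [ENNReal.iSup_eq_zero]
    intro γ a b h
    obtain ⟨q, hqU, hq⟩ := mem_closure_iff.1 (mem_closure_chronFuture hT h) _ hopen hz
    exact absurd hq (hsub hqU).2
  -- As `γ c ∈ Miss⁺(x)`, the arc from `γ c` to `z` gives a lower bound that does not depend on `i`.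
  obtain ⟨γ, a, b, hγ⟩ := mem_iInter.1 (hsub hz).1 0
  obtain ⟨c, hcU, harc⟩ := hγ.exists_final_arc (hopen.mem_nhds hz)
  have hpiece := harc.isPiecewise
  rw [hγ.target] at hpiece
  have hle : ∀ i, g.arcLength γ c b ≤ g.lorentzDist T (u i) z := fun i ↦
    arcLength_le_lorentzDist_of_mem_chronFuture (mem_iInter.1 (hsub hcU).1 i) hpiece
  have hpair : Tendsto (fun i ↦ (u i, z)) atTop (𝓝 (x, z)) :=
    hu.tendsto.prodMk_nhds tendsto_const_nhds
  have hlim (D : M → M → ℝ≥0∞) (hD : Continuous fun p : M × M ↦ D p.1 p.2) :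
      Tendsto (fun i ↦ D (u i) z) atTop (𝓝 (D x z)) := (hD.tendsto (x, z)).comp hpair
  have h0 := ge_of_tendsto' (hlim _ hcont) hle
  rw [hzero] at h0
  exact (arcLength_pos_of_isC1ArcIn harc).not_ge h0

end LorentzianMetric

theorem mainTheorem10
    {E : Type*} [NormedAddCommGroup E] [NormedSpace ℝ E] [FiniteDimensional ℝ E]
    {M : Type*} [TopologicalSpace M] [T2Space M] [ParacompactSpace M]
    [ChartedSpace E M] [IsManifold 𝓘(ℝ, E) ∞ M]
    (g : LorentzianMetric E M) (T : (x : M) → TangentSpace 𝓘(ℝ, E) x)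
    (hT : g.IsTimeOrientation T)
    (hMiss : ∃ (x : M) (u : ℕ → M), g.IsFutureDirectedSeqTo T u x ∧ (g.missFuture T u x).Nonempty) :
    (¬ Continuous fun p : M × M ↦ g.lorentzDist T p.1 p.2) ∧
      ∀ h : LorentzianMetric E M, g.ConformallyRelated h →
        ¬ Continuous fun p : M × M ↦ h.lorentzDist T p.1 p.2 := by
  obtain ⟨x, u, hu, hne⟩ := hMiss
  refine ⟨LorentzianMetric.not_continuous_lorentzDist hT hu hne, fun h hgh ↦ ?_⟩
  have hI : h.chronFuture T = g.chronFuture T := hgh.chronFuture_eq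
  refine LorentzianMetric.not_continuous_lorentzDist (x := x) (u := u) (hT.conformal hgh)
    ⟨fun i ↦ ?_, fun i ↦ ?_, hu.tendsto⟩ ?_
  · rw [hI]; exact hu.chain i
  · rw [hI]; exact hu.below i
  · rwa [LorentzianMetric.missFuture, hI]
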